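/- An arena is a countable directed graph in which every vertex has an outgoing edge, with the vertices partitioned into those controlled by Eve and those controlled by Adam. Let $c$ be a coloring of the vertices by $\{0,\dots,d\}$. For an infinite play $\pi=\pi_0\pi_1\cdots$ and a position $k$, let $$\mathrm{dist}_k(\pi,c)=\inf\{k'-k \mid k'\ge k,\ c(\pi_{k'})\text{ is even and } c(\pi_{k'})\le c(\pi_k)\}\in\mathbb N\cup\{\infty\}.$$ In the bounded parity game, Eve wins $\pi$ if and only if $\sup_k \mathrm{dist}_k(\pi,c)<\infty$. Her winning set is the set of vertices from which she has a winning strategy. A strategy with $n$ memory states is given by a set $M$ of $n$ memory states with an initial state, an update function that maps a memory state and a traversed edge to the next memory state, and a next-move function that depends only on the current vertex and the current memory state; it is positional if $n=1$. 1. In every bounded parity game, Eve has a single strategy with $\ell+1$ memory states that is winning from every vertex of her winning set, where $\ell$ is the number of odd colors in $\{0,\dots,d\}$. 2. In general Eve needs at least two memory states, that is, positional strategies do not suffice: there are a bounded parity game and a vertex $v_0$ of Eve's winning set such that no positional strategy of Eve is winning from $v_0$ (hence none is winning from her winning set). -/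

import Mathlib

namespace BoundedParityGames

/-- An arena on a vertex set `V`: a directed graph without dead ends whose vertices are
partitioned into the vertices of Eve (`eve`) and those of Adam (the complement of `eve`). -/
structure Arena (V : Type*) where
  eve : Set V
  edge : V → V → Prop
  exists_edge : ∀ v, ∃ v', edge v v'

/-- A strategy for the player who controls the vertices in `S`: `next w v` is the move prescribed
at the current vertex `v` after the history `w` (the previously visited vertices in chronological
order). Only the values at `v ∈ S` are ever used. -/
structure Strategy {V : Type*} (A : Arena V) (S : Set V) where
  next : List V → V → V
  legal : ∀ w, ∀ v ∈ S, A.edge v (next w v)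

abbrev EveStrategy {V : Type*} (A : Arena V) := Strategy A A.eve

abbrev AdamStrategy {V : Type*} (A : Arena V) := Strategy A A.eveᶜ

open Classical in
/-- The history and the current vertex after `n` steps of the play from `v₀` in which Eve follows
`σ` and Adam follows `τ`. -/
noncomputable def playState {V : Type*} {A : Arena V} (σ : EveStrategy A) (τ : AdamStrategy A)
    (v₀ : V) : ℕ → List V × V
  | 0 => ([], v₀)
  | n + 1 =>
    let w := (playState σ τ v₀ n).1
    let v := (playState σ τ v₀ n).2
    (w ++ [v], if v ∈ A.eve then σ.next w v else τ.next w v)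

/-- The unique play from `v₀` in which Eve follows `σ` and Adam follows `τ`. -/
noncomputable def play {V : Type*} {A : Arena V} (σ : EveStrategy A) (τ : AdamStrategy A)
    (v₀ : V) (n : ℕ) : V :=
  (playState σ τ v₀ n).2

/-- `σ` is winning for Eve for the condition `Ω` from the set `U` of initial vertices. -/
def WinsFrom {V : Type*} {A : Arena V} (σ : EveStrategy A) (Ω : Set (ℕ → V)) (U : Set V) : Prop :=
  ∀ v₀ ∈ U, ∀ τ : AdamStrategy A, play σ τ v₀ ∈ Ω

/-- The winning set of Eve. -/
def winningSet {V : Type*} (A : Arena V) (Ω : Set (ℕ → V)) : Set V :=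
  {v₀ | ∃ σ : EveStrategy A, WinsFrom σ Ω {v₀}}

/-- A memory structure with set of memory states `M`. Only the values of `update m u v` at
edges `(u, v)` of the arena matter. -/
structure MemoryStructure (V M : Type*) where
  init : M
  update : M → V → V → M

/-- The memory state reached from `m` after reading the edges of a finite path. -/
def MemoryStructure.run {V M : Type*} (𝓜 : MemoryStructure V M) : M → List V → M
  | m, u :: v :: w => 𝓜.run (𝓜.update m u v) (v :: w)
  | m, _ => m

/-- `σ` relies on the memory structure `𝓜`: its moves are given by a next-move function of the
current vertex and the current memory state. -/
def UsesMemory {V M : Type*} {A : Arena V} (σ : EveStrategy A) (𝓜 : MemoryStructure V M) : Prop :=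
  ∃ ν : V → M → V, ∀ w, ∀ v ∈ A.eve, σ.next w v = ν v (𝓜.run 𝓜.init (w ++ [v]))

/-- `σ` is a strategy with `k` memory states. -/
def UsesMemoryStates {V : Type*} {A : Arena V} (σ : EveStrategy A) (k : ℕ) : Prop :=
  ∃ 𝓜 : MemoryStructure V (Fin k), UsesMemory σ 𝓜

/-- `σ` is positional (memoryless): it relies on a memory structure with a single state. -/
def IsPositional {V : Type*} {A : Arena V} (σ : EveStrategy A) : Prop :=
  UsesMemoryStates σ 1

/-- The waiting time at position `k` of `π`: the number of steps until the next even color that is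
at most the color at position `k` (`⊤` if there is none). -/
noncomputable def waitingTime {V : Type*} {d : ℕ} (c : V → Fin (d + 1)) (π : ℕ → V) (k : ℕ) : ℕ∞ :=
  ⨅ k' ∈ {k' : ℕ | k ≤ k' ∧ Even (c (π k') : ℕ) ∧ c (π k') ≤ c (π k)}, ((k' - k : ℕ) : ℕ∞)

/-- The bounded parity condition: the waiting times are bounded from the start of the play. -/
def BndParity {V : Type*} {d : ℕ} (c : V → Fin (d + 1)) : Set (ℕ → V) :=
  {π | (⨆ k, waitingTime c π k) < ⊤}

/-- The number of odd colors in the color set `{0, …, d}`. -/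
def numOddColors (d : ℕ) : ℕ :=
  (Finset.univ.filter fun i : Fin (d + 1) => Odd (i : ℕ)).card

end BoundedParityGames

/-!
While the play is read, the least odd color that is not yet answered takes `ℓ + 1` values, counting
its absence. If every position is answered within `N` steps, then the states without an open request
recur with bounded gaps: a request still open when another one is answered has a smaller color, so
at most `d + 1` answers have to be awaited. In the product of the arena with this memory, the
bounded parity condition therefore becomes a bounded Büchi condition: some set of vertices has to be
visited with bounded gaps.

Bounded Büchi games are positional for Eve. The condition is tail-invariant, so the regions won by
positional strategies can be merged into a largest one, `Z`. Suppose that a strategy wins from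
outside `Z`. Among the histories that avoid `Z`, some history must have a uniform bound on the gaps
at all of its extensions: otherwise ever longer gaps could be appended to a single play. Moving at
every vertex as in the history with the earliest forced visit is a positional strategy that wins
from a vertex outside `Z`, a contradiction.

For the lower bound, Eve must take exactly once a detour whose length is chosen by Adam: a
positional strategy takes it never, or again and again, with unbounded lengths.
-/

namespace BoundedParityGames

section Paths

variable {H : Type*} {R : H → H → Prop}

/-- `π` is an infinite path of the directed graph `R`. -/
def IsPath (R : H → H → Prop) (π : ℕ → H) : Prop :=
  ∀ n, R (π n) (π (n + 1))

theorem IsPath.shift {π : ℕ → H} (hπ : IsPath R π) (n : ℕ) : IsPath R fun k => π (k + n) := by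
  intro k
  simpa only [add_right_comm] using hπ (k + n)

theorem exists_forall_getElem_eq_of_isPrefix {L : ℕ → List H} (hL : ∀ n, L n <+: L (n + 1))
    (hlen : ∀ n, n < (L n).length) :
    ∃ π : ℕ → H, ∀ n i, ∀ hi : i < (L n).length, (L n)[i] = π i := by
  have hmono : ∀ {m n}, m ≤ n → L m <+: L n := fun {m n} hmn =>
    Nat.le_induction List.prefix_rfl (fun n _ ih => ih.trans (hL n)) n hmn
  refine ⟨fun i => (L i)[i]'(hlen i), fun n i hi => ?_⟩
  rcases le_total n i with h | h
  · exact (hmono h).getElem hi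
  · exact ((hmono h).getElem (hlen i)).symm

/-- A Baire category argument: `hext` says that every requirement `Q n` is dense among the finite
paths from `h₀`. -/
theorem exists_isPath_of_forall_extension {h₀ : H} {Q : ℕ → List H → Prop}
    (hQ : ∀ n L, Q n L → n < L.length)
    (hext : ∀ n L, L.IsChain R → L.head? = some h₀ → ∃ K, (L ++ K).IsChain R ∧ Q n (L ++ K)) :
    ∃ π : ℕ → H, π 0 = h₀ ∧ IsPath R π ∧ ∀ n, ∃ m, Q n ((List.range m).map π) := by
  choose! K hKR hKQ using hext
  let L : ℕ → List H := fun n => Nat.rec [h₀] (fun n L => L ++ K n L) n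
  have hL : ∀ n, (L n).IsChain R ∧ (L n).head? = some h₀ := fun n => by
    induction n with
    | zero => exact ⟨.singleton _, rfl⟩
    | succ n ih => exact ⟨hKR n _ ih.1 ih.2, by simp [L, List.head?_append, ih.2]⟩
  have hLQ : ∀ n, Q n (L (n + 1)) := fun n => hKQ n _ (hL n).1 (hL n).2
  have hlen : ∀ n, n < (L (n + 1)).length := fun n => hQ n _ (hLQ n)
  obtain ⟨π, hπ⟩ := exists_forall_getElem_eq_of_isPrefix (L := fun n => L (n + 1))
    (fun n => List.prefix_append _ _) hlen
  refine ⟨π, ?_, fun n => ?_, fun n => ⟨(L (n + 1)).length, ?_⟩⟩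
  · have h0 : (L (0 + 1)).head? = some h₀ := (hL 1).2
    rw [List.head?_eq_getElem?, List.getElem?_eq_getElem (hlen 0), Option.some_inj] at h0
    exact (hπ 0 0 (hlen 0)).symm.trans h0
  · have hn := List.isChain_iff_getElem.1 (hL (n + 2)).1 n (hlen (n + 1))
    rwa [hπ (n + 1), hπ (n + 1)] at hn
  · convert hLQ n
    exact List.ext_getElem (by simp) fun i _ hi => by simp [← hπ n i hi]

end Paths

section BoundedGaps

variable {H : Type*} {R : H → H → Prop} {G : Set H}

/-- The bounded Büchi condition: the gaps between successive visits to `F` are bounded. -/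
def boundedBuchi (F : Set H) : Set (ℕ → H) :=
  {π | ∃ N, ∀ k, ∃ j ≤ N, π (k + j) ∈ F}

/-- Every path from `h` with `n` edges visits `G`; paths that cannot be continued to `n` edges
are ignored. -/
def MeetsWithin (R : H → H → Prop) (G : Set H) (n : ℕ) (h : H) : Prop :=
  ∀ L : List H, (h :: L).IsChain R → L.length = n → ∃ x ∈ h :: L, x ∈ G

theorem meetsWithin_zero_iff {h : H} : MeetsWithin R G 0 h ↔ h ∈ G :=
  ⟨fun hn => by simpa using hn [] (.singleton h) rfl, fun hG _ _ _ => ⟨h, List.mem_cons_self, hG⟩⟩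

theorem MeetsWithin.of_rel {n : ℕ} {h h' : H} (hn : MeetsWithin R G (n + 1) h) (hG : h ∉ G)
    (hR : R h h') : MeetsWithin R G n h' := by
  intro L hL hlen
  obtain ⟨x, hx, hxG⟩ := hn (h' :: L) (hL.cons_cons hR) (by simp [hlen])
  rcases List.mem_cons.1 hx with rfl | hx
  · exact absurd hxG hG
  · exact ⟨x, hx, hxG⟩

theorem exists_isChain_append_of_reflTransGen {L : List H} {h h' : H} (hL : L.IsChain R)
    (hlast : L.getLast? = some h) (hr : Relation.ReflTransGen R h h') :
    ∃ K X, L ++ K = X ++ [h'] ∧ (L ++ K).IsChain R := by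
  induction hr with
  | refl =>
    obtain ⟨X, rfl⟩ := List.getLast?_eq_some_iff.1 hlast
    exact ⟨[], X, by simp, by simpa using hL⟩
  | @tail a b _ hab ih =>
    obtain ⟨K, X, hX, hK⟩ := ih
    refine ⟨K ++ [b], L ++ K, by simp, ?_⟩
    rw [← List.append_assoc, List.isChain_append]
    exact ⟨hK, .singleton _, by simpa [hX] using hab⟩

theorem exists_chain_window_of_not_meetsWithin {L : List H} {h h' : H} {n : ℕ}
    (hL : L.IsChain R) (hlast : L.getLast? = some h) (hr : Relation.ReflTransGen R h h')
    (hn : ¬ MeetsWithin R G n h') :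
    ∃ K, (L ++ K).IsChain R ∧ ∃ k, k + n < (L ++ K).length ∧ ∀ x ∈ (L ++ K).drop k, x ∉ G := by
  obtain ⟨K, X, hX, hK⟩ := exists_isChain_append_of_reflTransGen hL hlast hr
  simp only [MeetsWithin, not_forall, not_exists, not_and] at hn
  obtain ⟨W, hW, rfl, hWG⟩ := hn
  have hLKW : L ++ (K ++ W) = X ++ h' :: W := by
    rw [← List.append_assoc, hX, List.append_assoc, List.singleton_append]
  refine ⟨K ++ W, ?_, X.length, ?_, ?_⟩
  · rw [hLKW, List.isChain_split]
    exact ⟨hX ▸ hK, hW⟩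
  · simp [hLKW]
  · simpa [hLKW] using hWG

/-- Otherwise one could extend finite paths so as to contain ever longer windows outside `G`. -/
theorem exists_forall_reachable_meetsWithin {h₀ : H}
    (hgaps : ∀ π : ℕ → H, π 0 = h₀ → IsPath R π → π ∈ boundedBuchi G) :
    ∃ h, Relation.ReflTransGen R h₀ h ∧
      ∃ N, ∀ h', Relation.ReflTransGen R h h' → MeetsWithin R G N h' := by
  by_contra! hbad
  obtain ⟨π, hπ0, hπ, hwin⟩ := exists_isPath_of_forall_extension (R := R) (h₀ := h₀)
    (Q := fun n L => ∃ k, k + n < L.length ∧ ∀ x ∈ L.drop k, x ∉ G)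
    (fun n _ ⟨k, hk, _⟩ => (Nat.le_add_left n k).trans_lt hk) (by
      intro n L hL hhead
      obtain ⟨T, rfl⟩ := List.head?_eq_some_iff.1 hhead
      have hreach := List.relationReflTransGen_of_exists_isChain_cons T hL rfl
      obtain ⟨h', hr, hn⟩ := hbad _ hreach n
      exact exists_chain_window_of_not_meetsWithin hL (List.getLast?_eq_getLast_of_ne_nil _) hr hn)
  obtain ⟨N, hN⟩ := hgaps π hπ0 hπ
  obtain ⟨m, k, hkm, hk⟩ := hwin N
  obtain ⟨j, hj, hG⟩ := hN k
  rw [List.length_map, List.length_range] at hkm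
  refine hk (π (k + j)) (List.mem_drop_iff_getElem.2 ⟨j, by simp; omega, by simp⟩) hG

end BoundedGaps

section Plays

variable {V : Type*} {A : Arena V}

/-- `π` is a play of the arena in which the player who controls `S` follows `σ`. -/
def Strategy.IsPlay {S : Set V} (σ : Strategy A S) (π : ℕ → V) : Prop :=
  ∀ n, A.edge (π n) (π (n + 1)) ∧
    (π n ∈ S → π (n + 1) = σ.next ((List.range n).map π) (π n))

theorem playState_fst (σ : EveStrategy A) (τ : AdamStrategy A) (v₀ : V) (n : ℕ) :
    (playState σ τ v₀ n).1 = (List.range n).map (play σ τ v₀) := by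
  induction n with
  | zero => rfl
  | succ n ih => simp [playState, ih, List.range_succ, play]

open Classical in
theorem play_succ (σ : EveStrategy A) (τ : AdamStrategy A) (v₀ : V) (n : ℕ) :
    play σ τ v₀ (n + 1) = if play σ τ v₀ n ∈ A.eve
      then σ.next ((List.range n).map (play σ τ v₀)) (play σ τ v₀ n)
      else τ.next ((List.range n).map (play σ τ v₀)) (play σ τ v₀ n) := by
  rw [← playState_fst]
  rfl

theorem isPlay_play (σ : EveStrategy A) (τ : AdamStrategy A) (v₀ : V) :
    σ.IsPlay (play σ τ v₀) := by
  intro n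
  rw [play_succ]
  split_ifs with h
  · exact ⟨σ.legal _ _ h, fun _ => rfl⟩
  · exact ⟨τ.legal _ _ h, fun h' => absurd h' h⟩

theorem Strategy.IsPlay.exists_play_eq {σ : EveStrategy A} {π : ℕ → V} (hπ : σ.IsPlay π) :
    ∃ τ : AdamStrategy A, play σ τ (π 0) = π := by
  classical
  -- Adam copies `π`, reading the current position off the length of the history.
  let τ : AdamStrategy A :=
    { next := fun w v => if A.edge v (π (w.length + 1)) then π (w.length + 1)
        else (A.exists_edge v).choose
      legal := fun w v _ => by
        split_ifs with h
        · exact h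
        · exact (A.exists_edge v).choose_spec }
  refine ⟨τ, funext fun n => ?_⟩
  induction n using Nat.strong_induction_on with
  | _ n ih =>
    cases n with
    | zero => rfl
    | succ n =>
      have hw : (List.range n).map (play σ τ (π 0)) = (List.range n).map π :=
        List.map_congr_left fun i hi => ih i ((List.mem_range.1 hi).trans n.lt_succ_self)
      rw [play_succ, hw, ih n n.lt_succ_self]
      split_ifs with he
      · exact ((hπ n).2 he).symm
      · simp [τ, (hπ n).1]

theorem winsFrom_iff_forall_isPlay {σ : EveStrategy A} {Ω : Set (ℕ → V)} {U : Set V} :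
    WinsFrom σ Ω U ↔ ∀ π, σ.IsPlay π → π 0 ∈ U → π ∈ Ω := by
  refine ⟨fun h π hπ h0 => ?_, fun h v₀ hv τ => h _ (isPlay_play σ τ v₀) hv⟩
  obtain ⟨τ, hτ⟩ := hπ.exists_play_eq
  exact hτ ▸ h _ h0 τ

/-- The successor relation of the tree of histories, each paired with its current vertex, that are
compatible with `σ`. -/
def Strategy.HistoryStep {S : Set V} (σ : Strategy A S) (h h' : List V × V) : Prop :=
  h'.1 = h.1 ++ [h.2] ∧ A.edge h.2 h'.2 ∧ (h.2 ∈ S → h'.2 = σ.next h.1 h.2)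

theorem Strategy.isPlay_of_isPath_historyStep {S : Set V} {σ : Strategy A S}
    {ρ : ℕ → List V × V} (hρ : IsPath σ.HistoryStep ρ) (h0 : (ρ 0).1 = []) :
    σ.IsPlay fun n => (ρ n).2 := by
  have hw : ∀ n, (ρ n).1 = (List.range n).map fun i => (ρ i).2 := fun n => by
    induction n with
    | zero => exact h0
    | succ n ih => simp [(hρ n).1, ih, List.range_succ]
  exact fun n => ⟨(hρ n).2.1, fun he => hw n ▸ (hρ n).2.2 he⟩

end Plays

section TailInvariant

variable {V : Type*} {Ω : Set (ℕ → V)}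

/-- Whether a play belongs to `Ω` does not depend on its first vertex. -/
def IsTailInvariant (Ω : Set (ℕ → V)) : Prop :=
  ∀ π, (fun n => π (n + 1)) ∈ Ω ↔ π ∈ Ω

theorem IsTailInvariant.shift_mem_iff (hΩ : IsTailInvariant Ω) (π : ℕ → V) (n : ℕ) :
    (fun k => π (k + n)) ∈ Ω ↔ π ∈ Ω := by
  induction n with
  | zero => rfl
  | succ n ih =>
    rw [← ih, ← hΩ fun k => π (k + n)]
    simp only [add_right_comm, add_assoc]

theorem isTailInvariant_boundedBuchi (F : Set V) : IsTailInvariant (boundedBuchi F) := by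
  refine fun π => ⟨fun ⟨N, hN⟩ => ⟨N + 1, fun k => ?_⟩, fun ⟨N, hN⟩ => ⟨N, fun k => ?_⟩⟩
  · obtain ⟨j, hj, hF⟩ := hN k
    exact ⟨j + 1, by omega, hF⟩
  · obtain ⟨j, hj, hF⟩ := hN (k + 1)
    exact ⟨j, hj, by simpa only [add_right_comm] using hF⟩

end TailInvariant

/-- A positional strategy of Eve, given by its next-move function. -/
structure PositionalStrategy {V : Type*} (A : Arena V) where
  move : V → V
  legal : ∀ v ∈ A.eve, A.edge v (move v)

namespace PositionalStrategy

variable {V : Type*} {A : Arena V} {Ω : Set (ℕ → V)} {s t : PositionalStrategy A}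

instance : Nonempty (PositionalStrategy A) :=
  ⟨⟨fun v => (A.exists_edge v).choose, fun v _ => (A.exists_edge v).choose_spec⟩⟩

/-- The moves of the game that remain possible when Eve follows `s`. -/
def Step (s : PositionalStrategy A) (u v : V) : Prop :=
  A.edge u v ∧ (u ∈ A.eve → v = s.move u)

/-- The set of vertices from which `s` wins. -/
def region (s : PositionalStrategy A) (Ω : Set (ℕ → V)) : Set V :=
  {v | ∀ π, π 0 = v → IsPath s.Step π → π ∈ Ω}

theorem mem_region_of_step (hΩ : IsTailInvariant Ω) {u v : V} (hu : u ∈ s.region Ω)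
    (huv : s.Step u v) : v ∈ s.region Ω := by
  rintro π rfl hπ
  refine (hΩ fun n => Nat.casesOn n u π).2 (hu _ rfl ?_)
  rintro (_ | n)
  exacts [huv, hπ n]

theorem region_subset_region_of_eqOn (hΩ : IsTailInvariant Ω)
    (hst : Set.EqOn s.move t.move (t.region Ω)) : t.region Ω ⊆ s.region Ω := by
  rintro v hv π rfl hπ
  have hstep : ∀ n, π n ∈ t.region Ω → t.Step (π n) (π (n + 1)) := fun n hn =>
    ⟨(hπ n).1, fun he => ((hπ n).2 he).trans (hst hn)⟩
  have hmem : ∀ n, π n ∈ t.region Ω := fun n => by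
    induction n with
    | zero => exact hv
    | succ n ih => exact mem_region_of_step hΩ ih (hstep n ih)
  exact hv π rfl fun n => hstep n (hmem n)

theorem mem_region_of_forall_avoiding (hΩ : IsTailInvariant Ω) {U : Set V}
    (hU : U ⊆ s.region Ω) {v : V}
    (hv : ∀ π, π 0 = v → IsPath s.Step π → (∀ n, π n ∉ U) → π ∈ Ω) : v ∈ s.region Ω := by
  intro π h0 hπ
  by_cases hmeet : ∃ n, π n ∈ U
  · obtain ⟨n, hn⟩ := hmeet
    exact (hΩ.shift_mem_iff π n).1 (hU hn _ (by simp) (hπ.shift n))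
  · exact hv π h0 hπ (not_exists.1 hmeet)

/-- Well-order the positional strategies and let every vertex follow the first one that wins from
it. The strategy followed only decreases along a play, so it is eventually constant. -/
theorem exists_forall_region_subset (A : Arena V) (hΩ : IsTailInvariant Ω) :
    ∃ s : PositionalStrategy A, ∀ t : PositionalStrategy A, t.region Ω ⊆ s.region Ω := by
  obtain ⟨_, _⟩ := exists_wellFoundedLT (PositionalStrategy A)
  have hfirst : ∀ v, ∃ i : PositionalStrategy A, ∀ t : PositionalStrategy A,
      v ∈ t.region Ω → v ∈ i.region Ω ∧ i ≤ t := fun v => by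
    by_cases hne : {t : PositionalStrategy A | v ∈ t.region Ω}.Nonempty
    · exact ⟨wellFounded_lt.min _ hne, fun t ht =>
        ⟨wellFounded_lt.min_mem _ hne,
          not_lt.1 (wellFounded_lt.not_lt_min {t : PositionalStrategy A | v ∈ t.region Ω} ht)⟩⟩
    · exact ⟨Classical.arbitrary _, fun t ht => absurd ⟨t, ht⟩ hne⟩
  choose first hfirst using hfirst
  let s : PositionalStrategy A := ⟨fun v => (first v).move v, fun v => (first v).legal v⟩
  have hs : ∀ i v, first v = i → v ∈ i.region Ω → v ∈ s.region Ω := fun i => by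
    induction i using WellFoundedLT.induction with
    | ind i ih =>
      intro v hvi hv
      refine mem_region_of_forall_avoiding hΩ (U := {u | u ∈ (first u).region Ω ∧ first u < i})
        (fun u hu => ih _ hu.2 u rfl hu.1) fun π h0 hπ havoid => ?_
      have hstep : ∀ n, first (π n) = i → i.Step (π n) (π (n + 1)) := fun n hn => hn ▸ hπ n
      have hconst : ∀ n, π n ∈ i.region Ω ∧ first (π n) = i := fun n => by
        induction n with
        | zero => exact h0 ▸ ⟨hv, hvi⟩
        | succ n ihn =>
          have hmem := mem_region_of_step hΩ ihn.1 (hstep n ihn.2)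
          have hle := hfirst _ i hmem
          exact ⟨hmem, hle.2.eq_of_not_lt fun hlt => havoid _ ⟨hle.1, hlt⟩⟩
      exact hv π h0 fun n => hstep n (hconst n).2
  exact ⟨s, fun t v hv => hs _ v rfl (hfirst v t hv).1⟩

theorem subset_region_boundedBuchi_of_rank {F U Y : Set V} {r : V → ℕ} {N : ℕ}
    (hU : U ⊆ s.region (boundedBuchi F)) (hrN : ∀ v ∈ Y, r v ≤ N)
    (hstep : ∀ u ∈ Y, ∀ v ∉ U, s.Step u v → v ∈ Y ∧ (u ∉ F → r v < r u)) :
    Y ⊆ s.region (boundedBuchi F) := by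
  intro v hv
  refine mem_region_of_forall_avoiding (isTailInvariant_boundedBuchi F) hU
    fun π h0 hπ havoid => ?_
  have hmem : ∀ n, π n ∈ Y := fun n => by
    induction n with
    | zero => exact h0 ▸ hv
    | succ n ih => exact (hstep _ ih _ (havoid _) (hπ n)).1
  have hdesc : ∀ n, π n ∉ F → r (π (n + 1)) < r (π n) := fun n =>
    (hstep _ (hmem n) _ (havoid _) (hπ n)).2
  have hvisit : ∀ m k, r (π k) ≤ m → ∃ j ≤ m, π (k + j) ∈ F := fun m => by
    induction m with
    | zero => exact fun k hk => ⟨0, le_rfl, by_contra fun hF => by have := hdesc k hF; omega⟩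
    | succ m ih =>
      intro k hk
      by_cases hF : π k ∈ F
      · exact ⟨0, by omega, hF⟩
      · obtain ⟨j, hj, hjF⟩ := ih (k + 1) (by have := hdesc k hF; omega)
        exact ⟨j + 1, by omega, Nat.add_right_comm k 1 j ▸ hjF⟩
  exact ⟨N, fun k => hvisit N k (hrN _ (hmem k))⟩

end PositionalStrategy

section BoundedBuchi

variable {V : Type*} {A : Arena V} {F : Set V}

theorem exists_rank_of_forall_reachable_meetsWithin {R : List V × V → List V × V → Prop}
    {h : List V × V} {N : ℕ}
    (hN : ∀ h', Relation.ReflTransGen R h h' → MeetsWithin R (Prod.snd ⁻¹' F) N h') :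
    ∃ (r : V → ℕ) (g : V → List V), ∀ w v, Relation.ReflTransGen R h (w, v) →
      r v ≤ N ∧ Relation.ReflTransGen R h (g v, v) ∧
        MeetsWithin R (Prod.snd ⁻¹' F) (r v) (g v, v) ∧
        ∀ k, MeetsWithin R (Prod.snd ⁻¹' F) k (w, v) → r v ≤ k := by
  let ranks : V → Set ℕ := fun v => {k | ∃ w, Relation.ReflTransGen R h (w, v) ∧
    MeetsWithin R (Prod.snd ⁻¹' F) k (w, v)}
  have hwitness : ∀ v, ∃ g, (ranks v).Nonempty → Relation.ReflTransGen R h (g, v) ∧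
      MeetsWithin R (Prod.snd ⁻¹' F) (sInf (ranks v)) (g, v) := fun v => by
    by_cases hne : (ranks v).Nonempty
    · obtain ⟨g, hg⟩ := Nat.sInf_mem hne
      exact ⟨g, fun _ => hg⟩
    · exact ⟨[], fun h' => absurd h' hne⟩
  choose g hg using hwitness
  refine ⟨fun v => sInf (ranks v), g, fun w v hw => ?_⟩
  have hmem : N ∈ ranks v := ⟨w, hw, hN _ hw⟩
  obtain ⟨hreach, hmeets⟩ := hg v ⟨N, hmem⟩
  exact ⟨Nat.sInf_le hmem, hreach, hmeets, fun k hk => Nat.sInf_le ⟨w, hw, hk⟩⟩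

/-- At each vertex outside `t.region (boundedBuchi F)`, Eve moves as `σ` does at the history that
forces the earliest visit to `F`; this makes the time to that visit a rank. -/
theorem exists_snd_mem_region_of_meetsWithin (σ : EveStrategy A) (t : PositionalStrategy A)
    {h : List V × V} {N : ℕ} (hh : h.2 ∉ t.region (boundedBuchi F))
    (hN : ∀ h', Relation.ReflTransGen
        (fun a b => σ.HistoryStep a b ∧ b.2 ∉ t.region (boundedBuchi F)) h h' →
      MeetsWithin (fun a b => σ.HistoryStep a b ∧ b.2 ∉ t.region (boundedBuchi F))
        (Prod.snd ⁻¹' F) N h') :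
    ∃ s : PositionalStrategy A, h.2 ∈ s.region (boundedBuchi F) := by
  classical
  set Z := t.region (boundedBuchi F)
  set R : List V × V → List V × V → Prop := fun a b => σ.HistoryStep a b ∧ b.2 ∉ Z
  obtain ⟨r, g, hrank⟩ := exists_rank_of_forall_reachable_meetsWithin hN
  let s : PositionalStrategy A :=
    { move := fun v => if v ∈ Z then t.move v else σ.next (g v) v
      legal := fun v hv => by
        split_ifs
        exacts [t.legal v hv, σ.legal _ v hv] }
  have hZs : Z ⊆ s.region (boundedBuchi F) :=
    PositionalStrategy.region_subset_region_of_eqOn (isTailInvariant_boundedBuchi F)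
      fun v hv => if_pos hv
  let Y : Set V := {v | v ∉ Z ∧ ∃ w, Relation.ReflTransGen R h (w, v)}
  refine ⟨s, PositionalStrategy.subset_region_boundedBuchi_of_rank (Y := Y) hZs
    (fun v ⟨_, w, hw⟩ => (hrank w v hw).1) (fun u ⟨huZ, w, hw⟩ v hvZ huv => ?_)
    ⟨hh, h.1, Relation.ReflTransGen.refl⟩⟩
  obtain ⟨-, hreach, hmeets, -⟩ := hrank w u hw
  have hstep : R (g u, u) (g u ++ [u], v) :=
    ⟨⟨rfl, huv.1, fun he => (huv.2 he).trans (if_neg huZ)⟩, hvZ⟩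
  obtain ⟨-, -, -, hmin⟩ := hrank _ v (hreach.tail hstep)
  refine ⟨⟨hvZ, _, hreach.tail hstep⟩, fun huF => ?_⟩
  cases hr : r u with
  | zero =>
    have hF : (g u, u) ∈ Prod.snd ⁻¹' F := meetsWithin_zero_iff.1 (hr ▸ hmeets)
    exact absurd hF huF
  | succ k => exact Nat.lt_succ_of_le (hmin k ((hr ▸ hmeets).of_rel huF hstep))

/-- A winning strategy outside the largest positional winning region would have, somewhere below
its root, a uniform bound on the gaps, and could be made positional from there on. -/
theorem mem_region_boundedBuchi_of_mem_winningSet {t : PositionalStrategy A}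
    (ht : ∀ s : PositionalStrategy A, s.region (boundedBuchi F) ⊆ t.region (boundedBuchi F))
    {v₀ : V} (hv₀ : v₀ ∈ winningSet A (boundedBuchi F)) : v₀ ∈ t.region (boundedBuchi F) := by
  obtain ⟨σ, hσ⟩ := hv₀
  by_contra hZ
  obtain ⟨h, hreach, N, hN⟩ := exists_forall_reachable_meetsWithin
    (R := fun a b => σ.HistoryStep a b ∧ b.2 ∉ t.region (boundedBuchi F)) (h₀ := ([], v₀))
    (G := Prod.snd ⁻¹' F) fun ρ hρ0 hρ =>
      winsFrom_iff_forall_isPlay.1 hσ _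
        (Strategy.isPlay_of_isPath_historyStep (fun n => (hρ n).1) (by rw [hρ0])) (by simp [hρ0])
  have hh : h.2 ∉ t.region (boundedBuchi F) := by
    rcases hreach.cases_tail with rfl | ⟨_, _, hstep⟩
    exacts [hZ, hstep.2]
  obtain ⟨s, hs⟩ := exists_snd_mem_region_of_meetsWithin σ t hh hN
  exact hh (ht s hs)

theorem exists_winningSet_boundedBuchi_subset_region (A : Arena V) (F : Set V) :
    ∃ s : PositionalStrategy A, winningSet A (boundedBuchi F) ⊆ s.region (boundedBuchi F) := by
  obtain ⟨s, hs⟩ :=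
    PositionalStrategy.exists_forall_region_subset A (isTailInvariant_boundedBuchi F)
  exact ⟨s, fun v hv => mem_region_boundedBuchi_of_mem_winningSet hs hv⟩

end BoundedBuchi

section Product

variable {V M : Type*} {A : Arena V} {𝓜 : MemoryStructure V M}

namespace MemoryStructure

/-- The memory state after the first `n` edges of `π`. -/
def stateAt (𝓜 : MemoryStructure V M) (π : ℕ → V) : ℕ → M
  | 0 => 𝓜.init
  | n + 1 => 𝓜.update (𝓜.stateAt π n) (π n) (π (n + 1))

theorem run_append_pair (m : M) (w : List V) (u v : V) :
    𝓜.run m (w ++ [u] ++ [v]) = 𝓜.update (𝓜.run m (w ++ [u])) u v := by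
  induction w generalizing m with
  | nil => rfl
  | cons a w ih =>
    cases w with
    | nil => rfl
    | cons b w => exact ih (𝓜.update m a b)

theorem run_init_map_range (π : ℕ → V) (n : ℕ) :
    𝓜.run 𝓜.init ((List.range n).map π ++ [π n]) = 𝓜.stateAt π n := by
  induction n with
  | zero => rfl
  | succ n ih =>
    rw [List.range_succ, List.map_append, List.map_singleton, run_append_pair, ih, stateAt]

/-- The run of the product arena over the path `π`. -/
def lift (𝓜 : MemoryStructure V M) (π : ℕ → V) (n : ℕ) : V × M :=
  (π n, 𝓜.stateAt π n)

/-- The memory structure `𝓜` with its states renamed along `φ`. -/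
def rename {M' : Type*} (𝓜 : MemoryStructure V M) (φ : M ≃ M') : MemoryStructure V M' where
  init := φ 𝓜.init
  update m u v := φ (𝓜.update (φ.symm m) u v)

theorem run_rename {M' : Type*} (φ : M ≃ M') (m : M) (w : List V) :
    (𝓜.rename φ).run (φ m) w = φ (𝓜.run m w) := by
  induction w generalizing m with
  | nil => rfl
  | cons u w ih =>
    cases w with
    | nil => rfl
    | cons v w => simpa [run, rename] using ih (𝓜.update m u v)

end MemoryStructure

theorem UsesMemory.usesMemoryStates [Fintype M] {σ : EveStrategy A} (hσ : UsesMemory σ 𝓜) {k : ℕ}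
    (hk : Fintype.card M = k) : UsesMemoryStates σ k := by
  obtain ⟨ν, hν⟩ := hσ
  let φ := Fintype.equivFinOfCardEq hk
  refine ⟨𝓜.rename φ, fun v m => ν v (φ.symm m), fun w v hv => ?_⟩
  have hrun : (𝓜.rename φ).run (𝓜.rename φ).init (w ++ [v]) = φ (𝓜.run 𝓜.init (w ++ [v])) :=
    𝓜.run_rename φ 𝓜.init (w ++ [v])
  simp only [hν w v hv, hrun, φ.symm_apply_apply]

/-- The product of an arena with a memory structure, in which the memory state is part of the
vertex: a strategy relying on `𝓜` is a positional strategy in the product. -/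
def Arena.product (A : Arena V) (𝓜 : MemoryStructure V M) : Arena (V × M) where
  eve := {x | x.1 ∈ A.eve}
  edge x y := A.edge x.1 y.1 ∧ y.2 = 𝓜.update x.2 x.1 y.1
  exists_edge x :=
    let ⟨v, hv⟩ := A.exists_edge x.1
    ⟨(v, 𝓜.update x.2 x.1 v), hv, rfl⟩

theorem eq_lift_of_isPath_product {ρ : ℕ → V × M} (hρ : IsPath (A.product 𝓜).edge ρ)
    (h0 : (ρ 0).2 = 𝓜.init) : ρ = 𝓜.lift fun n => (ρ n).1 := by
  refine funext fun n => Prod.ext rfl ?_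
  induction n with
  | zero => exact h0
  | succ n ih => exact (hρ n).2.trans (congrArg (fun m => 𝓜.update m _ _) ih)

theorem mk_init_mem_winningSet_product {Ω : Set (ℕ → V × M)} {v : V}
    (hv : v ∈ winningSet A (𝓜.lift ⁻¹' Ω)) : (v, 𝓜.init) ∈ winningSet (A.product 𝓜) Ω := by
  obtain ⟨σ, hσ⟩ := hv
  let σ' : EveStrategy (A.product 𝓜) :=
    { next := fun w x =>
        (σ.next (w.map Prod.fst) x.1, 𝓜.update x.2 x.1 (σ.next (w.map Prod.fst) x.1))
      legal := fun w x hx => ⟨σ.legal _ _ hx, rfl⟩ }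
  refine ⟨σ', winsFrom_iff_forall_isPlay.2 fun ρ hρ h0 => ?_⟩
  have h0 : ρ 0 = (v, 𝓜.init) := h0
  have hplay : σ.IsPlay fun n => (ρ n).1 := fun n => by
    refine ⟨(hρ n).1.1, fun he => ?_⟩
    have hnext := congrArg Prod.fst ((hρ n).2 he)
    simpa [σ', Function.comp_def] using hnext
  rw [eq_lift_of_isPath_product (fun n => (hρ n).1) (congrArg Prod.snd h0)]
  exact winsFrom_iff_forall_isPlay.1 hσ _ hplay (congrArg Prod.fst h0)

theorem exists_usesMemory_of_product (s : PositionalStrategy (A.product 𝓜))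
    (Ω : Set (ℕ → V × M)) : ∃ σ : EveStrategy A, UsesMemory σ 𝓜 ∧
      WinsFrom σ (𝓜.lift ⁻¹' Ω) {v | (v, 𝓜.init) ∈ s.region Ω} := by
  let σ : EveStrategy A :=
    { next := fun w v => (s.move (v, 𝓜.run 𝓜.init (w ++ [v]))).1
      legal := fun w v hv => (s.legal (v, _) hv).1 }
  refine ⟨σ, ⟨fun v m => (s.move (v, m)).1, fun _ _ _ => rfl⟩,
    winsFrom_iff_forall_isPlay.2 fun π hπ h0 => h0 _ rfl fun n => ⟨⟨(hπ n).1, rfl⟩, fun he => ?_⟩⟩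
  have hfst : π (n + 1) = (s.move (𝓜.lift π n)).1 :=
    ((hπ n).2 he).trans
      (congrArg (fun m => (s.move (π n, m)).1) (𝓜.run_init_map_range π n))
  exact Prod.ext hfst
    ((congrArg (𝓜.update _ _) hfst).trans (s.legal (𝓜.lift π n) he).2.symm)

end Product

section Requests

variable {d : ℕ}

/-- The odd colors among `e 0, …, e (k - 1)` that are not followed, before position `k`, by a
smaller even color. -/
def openRequests (e : ℕ → Fin (d + 1)) (k : ℕ) : Set (Fin (d + 1)) :=
  {p | ∃ i < k, e i = p ∧ ∀ j, i ≤ j → j < k → Even (e j : ℕ) → e i < e j}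

theorem openRequests_zero (e : ℕ → Fin (d + 1)) : openRequests e 0 = ∅ :=
  Set.eq_empty_of_forall_notMem fun _ ⟨_, hi, _⟩ => Nat.not_lt_zero _ hi

theorem openRequests_succ_of_even {e : ℕ → Fin (d + 1)} {k : ℕ} (hk : Even (e k : ℕ)) :
    openRequests e (k + 1) = {p ∈ openRequests e k | p < e k} := by
  ext p
  constructor
  · rintro ⟨i, hi, rfl, hopen⟩
    have hlt : e i < e k := hopen k (Nat.lt_succ_iff.1 hi) k.lt_succ_self hk
    have hik : i < k := (Nat.lt_succ_iff.1 hi).lt_of_ne fun h => (h ▸ hlt).false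
    exact ⟨⟨i, hik, rfl, fun j hij hj => hopen j hij (hj.trans k.lt_succ_self)⟩, hlt⟩
  · rintro ⟨⟨i, hi, rfl, hopen⟩, hlt⟩
    refine ⟨i, hi.trans k.lt_succ_self, rfl, fun j hij hj => ?_⟩
    rcases Nat.lt_succ_iff_lt_or_eq.1 hj with hjk | rfl
    exacts [hopen j hij hjk, fun _ => hlt]

theorem openRequests_succ_of_odd {e : ℕ → Fin (d + 1)} {k : ℕ} (hk : Odd (e k : ℕ)) :
    openRequests e (k + 1) = insert (e k) (openRequests e k) := by
  ext p
  constructor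
  · rintro ⟨i, hi, rfl, hopen⟩
    rcases Nat.lt_succ_iff_lt_or_eq.1 hi with hik | rfl
    · exact Or.inr ⟨i, hik, rfl, fun j hij hj => hopen j hij (hj.trans k.lt_succ_self)⟩
    · exact Or.inl rfl
  · have hne : ∀ j, Even (e j : ℕ) → j ≠ k := by
      rintro j heven rfl
      exact Nat.not_even_iff_odd.2 hk heven
    rintro (rfl | ⟨i, hi, rfl, hopen⟩)
    · exact ⟨k, k.lt_succ_self, rfl, fun j hkj hj heven =>
        (hne j heven (le_antisymm (Nat.lt_succ_iff.1 hj) hkj)).elim⟩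
    · exact ⟨i, hi.trans k.lt_succ_self, rfl, fun j hij hj heven =>
        hopen j hij ((Nat.lt_succ_iff.1 hj).lt_of_ne (hne j heven)) heven⟩

theorem exists_even_le_of_openRequests_eq_empty {e : ℕ → Fin (d + 1)} {k j : ℕ}
    (h : openRequests e (k + 1 + j) = ∅) : ∃ i ≤ j, Even (e (k + i) : ℕ) ∧ e (k + i) ≤ e k := by
  by_contra! hlt
  refine Set.eq_empty_iff_forall_notMem.1 h (e k) ⟨k, by omega, rfl, fun i hki hi he => ?_⟩
  obtain ⟨i, rfl⟩ := Nat.exists_eq_add_of_le hki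
  exact hlt i (by omega) he

/-- A request still open after an even color is smaller than it, and so is its answer: only
boundedly many successive answers are possible. -/
theorem exists_openRequests_eq_empty_of_even {e : ℕ → Fin (d + 1)} {N : ℕ}
    (h : ∀ k, ∃ j ≤ N, Even (e (k + j) : ℕ) ∧ e (k + j) ≤ e k) {n t : ℕ}
    (ht : Even (e t : ℕ)) (hn : (e t : ℕ) ≤ n) :
    ∃ j ≤ n * N, openRequests e (t + j + 1) = ∅ := by
  induction n generalizing t with
  | zero =>
    refine ⟨0, by omega, Set.eq_empty_of_forall_notMem fun p ⟨i, hi, _, hopen⟩ => ?_⟩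
    have hlt : e i < e t := hopen t (by omega) (by omega) ht
    omega
  | succ n ih =>
    rcases (openRequests e (t + 1)).eq_empty_or_nonempty with hempty | ⟨p, i, hi, -, hopen⟩
    · exact ⟨0, by omega, hempty⟩
    obtain ⟨j, hj, heven, hle⟩ := h i
    have hti : t < i + j := by
      by_contra! hit
      exact (hopen (i + j) (by omega) (by omega) heven).not_ge hle
    have hlt : e (i + j) < e t := hle.trans_lt (hopen t (by omega) (by omega) ht)
    obtain ⟨j', hj', hempty⟩ := ih heven (by omega)
    refine ⟨i + j - t + j', ?_, ?_⟩
    · rw [add_one_mul]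
      omega
    · rwa [show t + (i + j - t + j') = i + j + j' by omega]

theorem exists_forall_even_le_iff_exists_forall_openRequests_eq_empty {e : ℕ → Fin (d + 1)} :
    (∃ N, ∀ k, ∃ j ≤ N, Even (e (k + j) : ℕ) ∧ e (k + j) ≤ e k) ↔
      ∃ N, ∀ k, ∃ j ≤ N, openRequests e (k + j) = ∅ := by
  refine ⟨fun ⟨N, hN⟩ => ⟨N + d * N + 1, fun k => ?_⟩, fun ⟨N, hN⟩ => ⟨N, fun k => ?_⟩⟩
  · obtain ⟨j, hj, heven, -⟩ := hN k
    obtain ⟨j', hj', hempty⟩ := exists_openRequests_eq_empty_of_even hN heven (e (k + j)).is_le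
    exact ⟨j + j' + 1, by omega, by simpa only [add_assoc] using hempty⟩
  · obtain ⟨j, hj, hempty⟩ := hN (k + 1)
    obtain ⟨i, hi, hanswer⟩ := exists_even_le_of_openRequests_eq_empty hempty
    exact ⟨i, hi.trans hj, hanswer⟩

/-- The memory contents: an odd color, meant to be the least open request, or `none`. -/
abbrev Pending (d : ℕ) := Option {i : Fin (d + 1) // Odd (i : ℕ)}

theorem card_pending (d : ℕ) : Fintype.card (Pending d) = numOddColors d + 1 := by
  rw [Fintype.card_option, Fintype.card_subtype, numOddColors]

/-- `m` records the least element of the set `O` of open requests. -/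
def IsLeastPending (O : Set (Fin (d + 1))) : Pending d → Prop
  | none => O = ∅
  | some q => IsLeast O q

/-- The least open request after reading a further color. -/
def readColor : Pending d → Fin (d + 1) → Pending d
  | none, p => if h : Odd (p : ℕ) then some ⟨p, h⟩ else none
  | some q, p =>
    if h : Odd (p : ℕ) then (if p < q.1 then some ⟨p, h⟩ else some q)
    else if p ≤ q.1 then none else some q

theorem IsLeastPending.eq_none_iff {O : Set (Fin (d + 1))} {m : Pending d}
    (hm : IsLeastPending O m) : m = none ↔ O = ∅ := by
  cases m with
  | none => exact iff_of_true rfl hm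
  | some q => exact iff_of_false (Option.some_ne_none q) (Set.nonempty_of_mem hm.1).ne_empty

theorem IsLeastPending.readColor_of_even {O : Set (Fin (d + 1))} {m : Pending d}
    (hm : IsLeastPending O m) {p : Fin (d + 1)} (hp : Even (p : ℕ)) :
    IsLeastPending {q ∈ O | q < p} (readColor m p) := by
  cases m with
  | none =>
    obtain rfl : O = ∅ := hm
    simp [IsLeastPending, readColor, Nat.not_odd_iff_even.2 hp]
  | some q =>
    simp only [readColor, dif_neg (Nat.not_odd_iff_even.2 hp)]
    split_ifs with hpq
    · exact Set.eq_empty_of_forall_notMem fun i ⟨hi, hip⟩ => (hpq.trans (hm.2 hi)).not_gt hip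
    · exact ⟨⟨hm.1, not_le.1 hpq⟩, fun i hi => hm.2 hi.1⟩

theorem IsLeastPending.readColor_of_odd {O : Set (Fin (d + 1))} {m : Pending d}
    (hm : IsLeastPending O m) {p : Fin (d + 1)} (hp : Odd (p : ℕ)) :
    IsLeastPending (insert p O) (readColor m p) := by
  cases m with
  | none =>
    obtain rfl : O = ∅ := hm
    simp [IsLeastPending, readColor, hp]
  | some q =>
    have hmin : IsLeast (insert p O) (min p q) := hm.insert p
    simp only [readColor, dif_pos hp]
    split_ifs with hpq
    · rwa [min_eq_left hpq.le] at hmin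
    · rwa [min_eq_right (not_lt.1 hpq)] at hmin

end Requests

section Parity

variable {V : Type*} {d : ℕ}

theorem mem_bndParity_iff {c : V → Fin (d + 1)} {π : ℕ → V} :
    π ∈ BndParity c ↔
      ∃ N : ℕ, ∀ k, ∃ j ≤ N, Even (c (π (k + j)) : ℕ) ∧ c (π (k + j)) ≤ c (π k) := by
  constructor
  · intro h
    obtain ⟨N, hN⟩ := ENat.ne_top_iff_exists.1 (ne_of_lt (show _ < ⊤ from h))
    refine ⟨N, fun k => ?_⟩
    have hk : waitingTime c π k < ((N + 1 : ℕ) : ℕ∞) :=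
      lt_of_le_of_lt ((le_iSup _ k).trans_eq hN.symm) (by exact_mod_cast Nat.lt_succ_self N)
    simp only [waitingTime, iInf_lt_iff] at hk
    obtain ⟨k', ⟨hk', he, hc⟩, hlt⟩ := hk
    obtain ⟨j, rfl⟩ := Nat.exists_eq_add_of_le hk'
    rw [Nat.add_sub_cancel_left, Nat.cast_lt, Nat.lt_succ_iff] at hlt
    exact ⟨j, hlt, he, hc⟩
  · rintro ⟨N, hN⟩
    refine lt_of_le_of_lt (iSup_le fun k => ?_) (ENat.natCast_lt_top N)
    obtain ⟨j, hj, he, hc⟩ := hN k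
    refine (iInf₂_le (k + j) ⟨by omega, he, hc⟩).trans ?_
    rwa [Nat.add_sub_cancel_left, Nat.cast_le]

/-- The memory structure that stores the least open request among the colors of the vertices
already left. -/
def pendingMemory (c : V → Fin (d + 1)) : MemoryStructure V (Pending d) where
  init := none
  update m u _ := readColor m (c u)

theorem isLeastPending_stateAt_pendingMemory (c : V → Fin (d + 1)) (π : ℕ → V) (k : ℕ) :
    IsLeastPending (openRequests (c ∘ π) k) ((pendingMemory c).stateAt π k) := by
  induction k with
  | zero => exact openRequests_zero _
  | succ k ih =>
    rcases Nat.even_or_odd (c (π k) : ℕ) with heven | hodd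
    · exact openRequests_succ_of_even (e := c ∘ π) heven ▸ ih.readColor_of_even heven
    · exact openRequests_succ_of_odd (e := c ∘ π) hodd ▸ ih.readColor_of_odd hodd

theorem bndParity_eq_lift_preimage_boundedBuchi (c : V → Fin (d + 1)) :
    BndParity c = (pendingMemory c).lift ⁻¹' boundedBuchi {x | x.2 = none} := by
  ext π
  have hnone : ∀ k, (pendingMemory c).stateAt π k = none ↔ openRequests (c ∘ π) k = ∅ := fun k =>
    (isLeastPending_stateAt_pendingMemory c π k).eq_none_iff
  simp only [mem_bndParity_iff, Set.mem_preimage, boundedBuchi, MemoryStructure.lift,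
    Set.mem_ofPred_eq, hnone]
  exact exists_forall_even_le_iff_exists_forall_openRequests_eq_empty (e := c ∘ π)

theorem exists_usesMemoryStates_winsFrom_winningSet (A : Arena V) (c : V → Fin (d + 1)) :
    ∃ σ : EveStrategy A, UsesMemoryStates σ (numOddColors d + 1) ∧
      WinsFrom σ (BndParity c) (winningSet A (BndParity c)) := by
  rw [bndParity_eq_lift_preimage_boundedBuchi]
  obtain ⟨s, hs⟩ := exists_winningSet_boundedBuchi_subset_region
    (A.product (pendingMemory c)) {x | x.2 = none}
  obtain ⟨σ, hσ, hwins⟩ := exists_usesMemory_of_product s (boundedBuchi {x | x.2 = none})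
  exact ⟨σ, hσ.usesMemoryStates (card_pending d),
    fun v hv => hwins v (hs (mk_init_mem_winningSet_product hv))⟩

end Parity

section Detour

/-- From vertex `1` Eve may either stay there or move to the vertex `2` of Adam, who chooses a path
of arbitrary length back to vertex `1`. -/
def detourArena : Arena ℕ where
  eve := {1}
  edge u v := (u = 0 ∧ v = 1) ∨ (u = 1 ∧ (v = 1 ∨ v = 2)) ∨ (u = 2 ∧ 3 ≤ v) ∨ (u = 3 ∧ v = 1) ∨
    (4 ≤ u ∧ u = v + 1)
  exists_edge u := by
    rcases (by omega : u = 0 ∨ u = 1 ∨ u = 2 ∨ u = 3 ∨ 4 ≤ u) with h | h | h | h | h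
    · exact ⟨1, by omega⟩
    · exact ⟨1, by omega⟩
    · exact ⟨3, by omega⟩
    · exact ⟨1, by omega⟩
    · exact ⟨u - 1, by omega⟩

/-- Vertex `1` is neutral, vertex `3` answers all requests, and all other vertices are requests. -/
def detourColor (v : ℕ) : Fin 3 := if v = 1 then 2 else if v = 3 then 0 else 1

theorem odd_detourColor {v : ℕ} (h1 : v ≠ 1) (h3 : v ≠ 3) : Odd (detourColor v : ℕ) := by
  simp [detourColor, h1, h3]

theorem apply_add_of_isPath_detour {π : ℕ → ℕ} (hπ : IsPath detourArena.edge π) {k n : ℕ}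
    (hk : π k = n + 3) {i : ℕ} (hi : i ≤ n) : π (k + i) = n - i + 3 := by
  induction i with
  | zero => exact hk
  | succ i ih =>
    have hprev := ih (by omega)
    have hedge := hπ (k + i)
    simp only [detourArena] at hedge
    rw [← add_assoc]
    omega

theorem mem_bndParity_detourColor {π : ℕ → ℕ} {n : ℕ} (hn : π n = 3)
    (hstay : ∀ k > n, π k = 1) : π ∈ BndParity detourColor := by
  refine mem_bndParity_iff.2 ⟨n, fun k => ?_⟩
  rcases le_or_gt k n with hk | hk
  · refine ⟨n - k, by omega, ?_⟩
    simp [Nat.add_sub_cancel' hk, hn, detourColor]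
  · exact ⟨0, by omega, by simp [hstay k hk, detourColor]⟩

theorem zero_mem_winningSet_detour : 0 ∈ winningSet detourArena (BndParity detourColor) := by
  classical
  -- Eve takes the detour exactly once.
  let σ : EveStrategy detourArena :=
    { next := fun w _ => if 3 ∈ w then 1 else 2
      legal := fun w v hv => by
        obtain rfl : v = 1 := hv
        dsimp only [detourArena]
        split_ifs <;> omega }
  refine ⟨σ, winsFrom_iff_forall_isPlay.2 fun π hπ h0 => ?_⟩
  have h0 : π 0 = 0 := h0
  have hpath : IsPath detourArena.edge π := fun n => (hπ n).1
  have h1 : π 1 = 1 := by simpa [detourArena, h0] using hpath 0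
  have h2 : π 2 = 2 := by simpa [σ, List.range_succ, h0] using (hπ 1).2 h1
  obtain ⟨n, h3⟩ : ∃ n, π 3 = n + 3 := by
    simpa [detourArena, h2, le_iff_exists_add'] using hpath 2
  have hreturn : π (3 + n) = 3 := by
    simpa using apply_add_of_isPath_detour hpath h3 le_rfl
  refine mem_bndParity_detourColor hreturn fun k hk => ?_
  induction k, hk using Nat.le_induction with
  | base => simpa [detourArena, hreturn] using hpath (3 + n)
  | succ k hk ih =>
    have hvisited : 3 ∈ (List.range k).map π :=
      List.mem_map.2 ⟨3 + n, List.mem_range.2 hk, hreturn⟩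
    exact ((hπ k).2 ih).trans (if_pos hvisited)

/-- The play in which Eve always moves from `1` to `2`, and Adam chooses longer and longer
detours. -/
def detourPlay : ℕ → ℕ
  | 0 => 0
  | k + 1 =>
    match detourPlay k with
    | 0 => 1
    | 1 => 2
    | 2 => k + 4
    | 3 => 1
    | m + 4 => m + 3

theorem isPath_detourPlay : IsPath detourArena.edge detourPlay := by
  intro k
  rw [detourPlay]
  match detourPlay k with
  | 0 | 1 | 2 | 3 | m + 4 => simp [detourArena]

theorem detourPlay_succ_of_eq_one {k : ℕ} (hk : detourPlay k = 1) : detourPlay (k + 1) = 2 := by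
  rw [detourPlay, hk]

theorem exists_detourPlay_eq_two (k : ℕ) : ∃ j ≥ k, detourPlay j = 2 := by
  match hk : detourPlay k with
  | 0 => exact ⟨k + 2, by omega, detourPlay_succ_of_eq_one (by rw [detourPlay, hk])⟩
  | 1 => exact ⟨k + 1, by omega, detourPlay_succ_of_eq_one hk⟩
  | 2 => exact ⟨k, le_rfl, hk⟩
  | n + 3 =>
    have hreturn : detourPlay (k + n) = 3 := by
      simpa using apply_add_of_isPath_detour isPath_detourPlay hk le_rfl
    exact ⟨k + n + 2, by omega, detourPlay_succ_of_eq_one (by rw [detourPlay, hreturn])⟩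

theorem detourPlay_notMem_bndParity : detourPlay ∉ BndParity detourColor := by
  intro h
  obtain ⟨N, hN⟩ := mem_bndParity_iff.1 h
  obtain ⟨k, hk, hk2⟩ := exists_detourPlay_eq_two N
  have hstart : detourPlay (k + 1) = k + 1 + 3 := by rw [detourPlay, hk2]
  obtain ⟨j, hj, heven, -⟩ := hN (k + 1)
  rw [apply_add_of_isPath_detour isPath_detourPlay hstart (by omega)] at heven
  exact Nat.not_even_iff_odd.2 (odd_detourColor (by omega) (by omega)) heven

theorem zero_then_one_notMem_bndParity :
    (fun k => if k = 0 then 0 else 1) ∉ BndParity detourColor := by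
  intro h
  obtain ⟨N, hN⟩ := mem_bndParity_iff.1 h
  obtain ⟨j, -, heven, hle⟩ := hN 0
  rcases Nat.eq_zero_or_pos j with rfl | hj
  · simp [detourColor] at heven
  · simp [detourColor, hj.ne'] at hle

theorem IsPositional.exists_next_eq {V : Type*} {A : Arena V} {σ : EveStrategy A}
    (hσ : IsPositional σ) : ∃ ν : V → V, ∀ w, ∀ v ∈ A.eve, σ.next w v = ν v := by
  obtain ⟨𝓜, ν, hν⟩ := hσ
  exact ⟨fun v => ν v 0, fun w v hv => (hν w v hv).trans (congrArg _ (Subsingleton.elim _ _))⟩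

theorem not_winsFrom_detour_of_isPositional {σ : EveStrategy detourArena} (hσ : IsPositional σ) :
    ¬ WinsFrom σ (BndParity detourColor) {0} := by
  obtain ⟨ν, hν⟩ := hσ.exists_next_eq
  have hnext : ∀ w, σ.next w 1 = ν 1 := fun w => hν w 1 rfl
  intro hwins
  rw [winsFrom_iff_forall_isPlay] at hwins
  have hlegal : ν 1 = 1 ∨ ν 1 = 2 := by
    simpa [detourArena, hnext] using σ.legal [] 1 rfl
  rcases hlegal with h | h
  · refine zero_then_one_notMem_bndParity (hwins _ (fun k => ⟨?_, fun he => ?_⟩) rfl)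
    · rcases Nat.eq_zero_or_pos k with rfl | hk
      · simp [detourArena]
      · simp [detourArena, hk.ne']
    · simp only [show (if k = 0 then 0 else 1) = 1 from he, hnext, h, Nat.succ_ne_zero, if_false]
  · refine detourPlay_notMem_bndParity
      (hwins _ (fun k => ⟨isPath_detourPlay k, fun he => ?_⟩) rfl)
    have he : detourPlay k = 1 := he
    rw [detourPlay_succ_of_eq_one he, he, hnext, h]

end Detour

end BoundedParityGames

theorem mainTheorem6_general :
    (∀ (V : Type*) (A : BoundedParityGames.Arena V) (d : ℕ) (c : V → Fin (d + 1)),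
      ∃ σ : BoundedParityGames.EveStrategy A,
        BoundedParityGames.UsesMemoryStates σ (BoundedParityGames.numOddColors d + 1) ∧
        BoundedParityGames.WinsFrom σ (BoundedParityGames.BndParity c)
          (BoundedParityGames.winningSet A (BoundedParityGames.BndParity c))) ∧
    (∃ (V : Type) (_ : Countable V) (A : BoundedParityGames.Arena V) (d : ℕ)
        (c : V → Fin (d + 1)),
      ∃ v₀ ∈ BoundedParityGames.winningSet A (BoundedParityGames.BndParity c),
        ¬ ∃ σ : BoundedParityGames.EveStrategy A,
          BoundedParityGames.IsPositional σ ∧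
          BoundedParityGames.WinsFrom σ (BoundedParityGames.BndParity c) {v₀}) :=
  ⟨fun _ A _ c => BoundedParityGames.exists_usesMemoryStates_winsFrom_winningSet A c,
    ℕ, inferInstance, BoundedParityGames.detourArena, 2, BoundedParityGames.detourColor, 0,
    BoundedParityGames.zero_mem_winningSet_detour,
    fun ⟨_, hσ, hwins⟩ => BoundedParityGames.not_winsFrom_detour_of_isPositional hσ hwins⟩

theorem mainTheorem6 :
    (∀ (V : Type*) [Countable V] (A : BoundedParityGames.Arena V) (d : ℕ) (c : V → Fin (d + 1)),
      ∃ σ : BoundedParityGames.EveStrategy A,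
        BoundedParityGames.UsesMemoryStates σ (BoundedParityGames.numOddColors d + 1) ∧
        BoundedParityGames.WinsFrom σ (BoundedParityGames.BndParity c)
          (BoundedParityGames.winningSet A (BoundedParityGames.BndParity c))) ∧
    (∃ (V : Type) (_ : Countable V) (A : BoundedParityGames.Arena V) (d : ℕ)
        (c : V → Fin (d + 1)),
      ∃ v₀ ∈ BoundedParityGames.winningSet A (BoundedParityGames.BndParity c),
        ¬ ∃ σ : BoundedParityGames.EveStrategy A,
          BoundedParityGames.IsPositional σ ∧
          BoundedParityGames.WinsFrom σ (BoundedParityGames.BndParity c) {v₀}) := by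
  exact mainTheorem6_general.imp_left fun h V _ => h V
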